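/- Let $q\ge 2$, $\mathcal Q=\{1,\dots,q\}$, and let $\nu:2^{\mathcal Q}\to\mathbb R$ be a value function with $\nu(\emptyset)=0$. Identify a coalition $C\subseteq\mathcal Q$ with its indicator vector $Z\in\{0,1\}^q$ and write $\nu(Z)=\nu(C)$; let $\mathbf 1$ be the all-one vector, and let a tilde denote dropping the $q$-th component of a vector. Let $\phi=(\phi_j)_{j=1}^q$ be the Shapley values $$\phi_j=\frac1q\sum_{C\subseteq\mathcal Q\setminus\{j\}}\binom{q-1}{|C|}^{-1}\bigl(\nu(C\cup\{j\})-\nu(C)\bigr),$$ and let $p$ be the probability distribution on the coalitions $\emptyset\ne C\subsetneq\mathcal Q$ with weights $p(C)$ proportional to $\frac{q-1}{\binom{q}{|C|}\,|C|\,(q-|C|)}$. Put $$\mathcal J=\mathbb E_{Z\sim p}\bigl[(\widetilde Z-Z_q\widetilde{\mathbf 1})(\widetilde Z-Z_q\widetilde{\mathbf 1})^\top\bigr],\qquad \mathcal J_2=2\mathcal J,$$ $$\mathcal I_2=\mathbb E_{Z\sim p}\Bigl[4\Bigl(\tfrac{\nu(Z)+\nu(\mathbf 1)-\nu(\mathbf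 1-Z)}{2}-Z_q\nu(\mathbf 1)-(\widetilde Z-Z_q\widetilde{\mathbf 1})^\top\widetilde\phi\Bigr)^2(\widetilde Z-Z_q\widetilde{\mathbf 1})(\widetilde Z-Z_q\widetilde{\mathbf 1})^\top\Bigr].$$ Let $Z_1,Z_2,\dots$ be i.i.d. with distribution $p$. For $n\ge1$ let $\mathfrak Z_n\in\mathbb R^{2n\times(q-1)}$ be the design matrix with rows $(\widetilde Z-Z_q\widetilde{\mathbf 1})^\top$ and $Y_n\in\mathbb R^{2n}$ the response vector with entries $\nu(Z)-Z_q\nu(\mathbf 1)$, where $Z$ runs through the $2n$ coalitions $Z_1,\dots,Z_n,\mathbf 1-Z_1,\dots,\mathbf 1-Z_n$. The Paired-Sampling KernelSHAP estimator $\widehat\phi_n^{(PS)}$ is an $\mathbb R^{q-1}$-valued random vector with $\widehat\phi_n^{(PS)}=(\mathfrak Z_n^\top\mathfrak Z_n)^{-1}\mathfrak Z_n^\top Y_n$ whenever $\mathfrak Z_n$ has full rank $q-1$, and with arbitrary values otherwise. Assume that $\nu$ is not a bilinear form, i.e. there is no $A\in\mathbb R^{q\times q}$ with $\nu(Z)=Z^\top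 AZ$ for all $Z\in\{0,1\}^q$. Then $\mathcal J_2$ is invertible, $\mathcal J_2^{-1}\mathcal I_2\mathcal J_2^{-1}$ is positive semidefinite, and $$\sqrt n\,\bigl(\widehat\phi_n^{(PS)}-\widetilde\phi\bigr)\Longrightarrow\mathcal N\bigl(\mathbf 0,\ \mathcal J_2^{-1}\mathcal I_2\mathcal J_2^{-1}\bigr)\qquad(n\to\infty)$$ in distribution, where the normal distribution is allowed to be degenerate if the covariance matrix is singular. -/

import Mathlib

open MeasureTheory ProbabilityTheory Filter
open scoped Topology Matrix

namespace KernelSHAP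

/-- Coalitions of the `q` players `Fin q`. A coalition is identified with its binary
indicator vector `KernelSHAP.ind`. The σ-algebra on this finite set is Mathlib's one on `Finset`,
which is discrete here. -/
abbrev Coalition (q : ℕ) : Type := Finset (Fin q)

/-- The binary vector `Z ∈ {0,1}^q` of a coalition. -/
def ind {q : ℕ} (C : Coalition q) (j : Fin q) : ℝ := if j ∈ C then 1 else 0

/-- The unnormalised kernel weight; it vanishes on the empty and on the grand coalition. -/
noncomputable def kernelWeight (q : ℕ) (C : Coalition q) : ℝ :=
  if C ≠ ∅ ∧ C ≠ Finset.univ then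
    ((q : ℝ) - 1) / ((q.choose C.card : ℝ) * (C.card : ℝ) * ((q : ℝ) - (C.card : ℝ)))
  else 0

/-- The probability weights `p(C)` obtained by normalising the kernel weights. -/
noncomputable def prob (q : ℕ) (C : Coalition q) : ℝ :=
  (∑ C' : Coalition q, kernelWeight q C')⁻¹ * kernelWeight q C

/-- The distribution `p` as a measure on the set of coalitions. -/
noncomputable def law (q : ℕ) : Measure (Coalition q) :=
  ∑ C : Coalition q, ENNReal.ofReal (prob q C) • Measure.dirac C

/-- The Shapley value of player `j`,
`φ_j = q⁻¹ ∑_{C ⊆ Q \ {j}} (q-1 choose |C|)⁻¹ (ν(C ∪ {j}) - ν(C))`. -/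
noncomputable def shapley {q : ℕ} (ν : Coalition q → ℝ) (j : Fin q) : ℝ :=
  (q : ℝ)⁻¹ * ∑ C ∈ (Finset.univ.erase j).powerset,
    ((q - 1).choose C.card : ℝ)⁻¹ * (ν (insert j C) - ν C)

/-- The value function is a bilinear form, `ν(Z) = Zᵀ A Z` for all binary vectors `Z`. -/
def IsBilinearForm {q : ℕ} (ν : Coalition q → ℝ) : Prop :=
  ∃ A : Matrix (Fin q) (Fin q) ℝ, ∀ C : Coalition q, ν C = ind C ⬝ᵥ (A *ᵥ ind C)

/-! From here on there are `q = m + 1` players, the last one is `Fin.last m`, and vectors with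
the last component dropped are indexed by `Fin m`. -/

/-- The vector of the Shapley values of all players but the last one. -/
noncomputable def shapleyTilde {m : ℕ} (ν : Coalition (m + 1) → ℝ) : EuclideanSpace ℝ (Fin m) :=
  WithLp.toLp 2 fun j => shapley ν j.castSucc

/-- The covariate vector `Z̃ - Z_q 1̃ ∈ ℝ^(q-1)`. -/
def covariate {m : ℕ} (C : Coalition (m + 1)) (j : Fin m) : ℝ :=
  ind C j.castSucc - ind C (Fin.last m)

/-- The response `ν(Z) - Z_q ν(1)`. -/
def response {m : ℕ} (ν : Coalition (m + 1) → ℝ) (C : Coalition (m + 1)) : ℝ :=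
  ν C - ind C (Fin.last m) * ν Finset.univ

/-- The design matrix, with rows `Z̃_i - Z_{i,q} 1̃`, of a finite family of coalitions. -/
def design {m : ℕ} {ι : Type*} (c : ι → Coalition (m + 1)) : Matrix ι (Fin m) ℝ :=
  Matrix.of fun i => covariate (c i)

/-- The estimate `(𝔷ᵀ 𝔷)⁻¹ 𝔷ᵀ Y` computed from a finite family of coalitions (meaningful if the
design matrix has full column rank). -/
noncomputable def estimate {m : ℕ} {ι : Type*} [Fintype ι] (ν : Coalition (m + 1) → ℝ)
    (c : ι → Coalition (m + 1)) : EuclideanSpace ℝ (Fin m) :=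
  WithLp.toLp 2
    (((design c)ᵀ * design c)⁻¹ *ᵥ ((design c)ᵀ *ᵥ fun i => response ν (c i)))

/-- The family of `2n` coalitions `Z_1, …, Z_n, 1 - Z_1, …, 1 - Z_n`. -/
def paired {q n : ℕ} (c : Fin n → Coalition q) : Fin n ⊕ Fin n → Coalition q :=
  Sum.elim c fun i => (c i)ᶜ

/-- The matrix `𝒥 = E_{Z ∼ p}[(Z̃ - Z_q 1̃)(Z̃ - Z_q 1̃)ᵀ]`. -/
noncomputable def matJ (m : ℕ) : Matrix (Fin m) (Fin m) ℝ :=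
  ∑ C : Coalition (m + 1), prob (m + 1) C • Matrix.vecMulVec (covariate C) (covariate C)

/-- The matrix `𝒥₂ = 2 𝒥`. -/
noncomputable def matJ₂ (m : ℕ) : Matrix (Fin m) (Fin m) ℝ := (2 : ℝ) • matJ m

/-- The paired residual
`(ν(Z) + ν(1) - ν(1 - Z)) / 2 - Z_q ν(1) - (Z̃ - Z_q 1̃)ᵀ φ̃`, with `φ̃` the Shapley values. -/
noncomputable def pairedResidual {m : ℕ} (ν : Coalition (m + 1) → ℝ) (C : Coalition (m + 1)) : ℝ :=
  (ν C + ν Finset.univ - ν Cᶜ) / 2 - ind C (Fin.last m) * ν Finset.univ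
    - covariate C ⬝ᵥ (shapleyTilde ν).ofLp

/-- The matrix `ℐ₂`, the expectation under `Z ∼ p` of
`4 (paired residual)² (Z̃ - Z_q 1̃)(Z̃ - Z_q 1̃)ᵀ`. -/
noncomputable def matI₂ {m : ℕ} (ν : Coalition (m + 1) → ℝ) : Matrix (Fin m) (Fin m) ℝ :=
  ∑ C : Coalition (m + 1), prob (m + 1) C •
    ((4 * pairedResidual ν C ^ 2) • Matrix.vecMulVec (covariate C) (covariate C))

/-- The asymptotic covariance matrix `𝒥₂⁻¹ ℐ₂ 𝒥₂⁻¹`. -/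
noncomputable def matT₂ {m : ℕ} (ν : Coalition (m + 1) → ℝ) : Matrix (Fin m) (Fin m) ℝ :=
  (matJ₂ m)⁻¹ * matI₂ ν * (matJ₂ m)⁻¹

/-- `φhat n` is a Paired-Sampling KernelSHAP estimate from the first `n` sampled coalitions: for
each `n` it is a random vector which agrees with the estimate computed from `Z_1, …, Z_n` and their
complements whenever the paired design matrix has full rank `q - 1 = m`. In the other cases, where
the estimating equations do not have a unique solution, it is arbitrary. -/
structure IsPairedEstimator {m : ℕ} {Ω : Type*} [MeasurableSpace Ω] (P : Measure Ω)
    (ν : Coalition (m + 1) → ℝ) (Z : ℕ → Ω → Coalition (m + 1))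
    (φhat : ℕ → Ω → EuclideanSpace ℝ (Fin m)) : Prop where
  aemeasurable : ∀ n, AEMeasurable (φhat n) P
  eq_estimate : ∀ n ω, (design (paired fun i : Fin n => Z i ω)).rank = m →
    φhat n ω = estimate ν (paired fun i : Fin n => Z i ω)

end KernelSHAP

/-! The covariate is odd under complementation, so each sampled pair adds `2 * pairedResidual` times
the covariate to the score and twice a rank-one matrix to the gram matrix. When the gram matrix G is
invertible, √n times the error is exactly (n G⁻¹ 𝒥₂) applied to n^(-1/2) times the sum of i.i.d.
vectors `influence`, that is, 𝒥₂⁻¹ times the scores. The strong law gives n⁻¹ G → 𝒥₂ almost surely,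
so the matrix factor tends to 1. The sum satisfies a central limit theorem with covariance 𝒥₂⁻¹ ℐ₂
𝒥₂⁻¹, and Slutsky combines the two.

The combinatorial input is that the scores are centered: the Shapley values solve the population
least squares problem (`sum_prob_smul_covariate_residual`). This holds because kernel-weighted
contrasts of two players are multiples of Shapley differences (`sum_kernelWeight_mul_ind_sub`), and
the additive game built from the Shapley values has the same Shapley values as ν. -/

namespace KernelSHAP

/-! ### Shapley values and the kernel weights -/

section Shapley

variable {q m : ℕ}

lemma ind_compl (C : Coalition q) (j : Fin q) : ind Cᶜ j = 1 - ind C j := by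
  by_cases h : j ∈ C <;> simp [ind, h]

lemma covariate_compl (C : Coalition (m + 1)) : covariate Cᶜ = -covariate C := by
  ext j
  simp [covariate, ind_compl]

/-- The probability of a coalition which precedes `j` in a uniformly random order of `m + 1`
players, depending on the size `s` of the coalition. -/
noncomputable def shapleyWeight (m s : ℕ) : ℝ := (((m : ℝ) + 1) * (m.choose s : ℝ))⁻¹

lemma shapley_eq_sum_powerset (ν : Coalition (m + 1) → ℝ) (j : Fin (m + 1)) :
    shapley ν j = ∑ C ∈ (Finset.univ.erase j).powerset,
      shapleyWeight m C.card * (ν (insert j C) - ν C) := by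
  rw [shapley, Finset.mul_sum]
  refine Finset.sum_congr rfl fun C _ => ?_
  rw [shapleyWeight, mul_inv]
  simp
  ring

lemma sum_coalition_eq_sum_powerset_erase (f : Coalition q → ℝ) (j : Fin q) :
    ∑ C, f C = ∑ C ∈ (Finset.univ.erase j).powerset, (f C + f (insert j C)) := by
  rw [Finset.sum_add_distrib, ← Finset.sum_powerset_insert (Finset.notMem_erase _ _),
    Finset.insert_erase (Finset.mem_univ _), Finset.powerset_univ]

lemma shapleyWeight_succ {s : ℕ} (hs : s < m) :
    ((m : ℝ) - s) * shapleyWeight m (s + 1) = (s + 1) * shapleyWeight m s := by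
  have h := Nat.choose_succ_right_eq m s
  have hc : (0 : ℝ) < m.choose s := by exact_mod_cast Nat.choose_pos hs.le
  have hc' : (0 : ℝ) < m.choose (s + 1) := by exact_mod_cast Nat.choose_pos hs
  have h' : (m.choose (s + 1) : ℝ) * (s + 1) = m.choose s * (m - s) := by
    rw [← Nat.cast_sub hs.le]
    exact_mod_cast h
  unfold shapleyWeight
  field_simp
  linarith

/-- Bridge between the two weightings: in the difference of two Shapley values, a coalition
containing exactly one of the two players collects one Shapley weight from each of them, of sizes s
and s + 1. -/
lemma kernelWeight_eq_shapleyWeight (C : Coalition (m + 1)) {s : ℕ} (hs : s < m)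
    (hC : C.card = s + 1) :
    kernelWeight (m + 1) C =
      (m / (m + 1)) * (shapleyWeight m s + shapleyWeight m (s + 1)) := by
  have hne : C ≠ ∅ ∧ C ≠ Finset.univ := by
    constructor <;> rintro rfl
    · simp at hC
    · simp at hC
      omega
  have hms : (0 : ℝ) < (m : ℝ) - s := by
    have : (s : ℝ) < m := by exact_mod_cast hs
    linarith
  have hc : (0 : ℝ) < m.choose s := by exact_mod_cast Nat.choose_pos hs.le
  have h1 : shapleyWeight m (s + 1) = (s + 1) * shapleyWeight m s / (m - s) := by
    rw [← shapleyWeight_succ hs]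
    field_simp
  have h2 : ((m + 1).choose (s + 1) : ℝ) * (s + 1) = (m + 1) * m.choose s := by
    exact_mod_cast (Nat.add_one_mul_choose_eq m s).symm
  rw [kernelWeight, if_pos hne, hC, h1]
  have h3 : ((m + 1 : ℕ) : ℝ) - (s + 1 : ℕ) = m - s := by push_cast; ring
  rw [h3]
  push_cast
  rw [h2, shapleyWeight]
  field_simp
  ring

/-- The kernel weighted contrast of two players is proportional to the difference of their Shapley
values. -/
lemma sum_kernelWeight_mul_ind_sub (ν : Coalition (m + 1) → ℝ) (j l : Fin (m + 1)) :
    ∑ C, kernelWeight (m + 1) C * (ind C j - ind C l) * ν C =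
      (m / (m + 1)) * (shapley ν j - shapley ν l) := by
  rcases eq_or_ne j l with rfl | hjl
  · simp
  set S : Finset (Fin (m + 1)) := (Finset.univ.erase j).erase l with hS
  have hlS : l ∉ S := Finset.notMem_erase _ _
  have hjS : j ∉ S := by simp [hS]
  have e1 : Finset.univ.erase j = insert l S :=
    (Finset.insert_erase (by simp [hjl.symm])).symm
  have e2 : Finset.univ.erase l = insert j S := by
    rw [hS, Finset.erase_right_comm, Finset.insert_erase (by simp [hjl])]
  rw [sum_coalition_eq_sum_powerset_erase _ j, shapley_eq_sum_powerset, shapley_eq_sum_powerset,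
    e1, e2, Finset.sum_powerset_insert hlS, Finset.sum_powerset_insert hlS,
    Finset.sum_powerset_insert hjS, ← Finset.sum_add_distrib, ← Finset.sum_add_distrib,
    ← Finset.sum_add_distrib, ← Finset.sum_sub_distrib, Finset.mul_sum]
  refine Finset.sum_congr rfl fun D hD => ?_
  rw [Finset.mem_powerset] at hD
  have hl : l ∉ D := fun h => hlS (hD h)
  have hj : j ∉ D := fun h => hjS (hD h)
  have cl : (insert l D).card = D.card + 1 := Finset.card_insert_of_notMem hl
  have cj : (insert j D).card = D.card + 1 := Finset.card_insert_of_notMem hj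
  have hDm : D.card < m := by
    have h1 : (insert j (insert l D)).card = D.card + 2 := by
      rw [Finset.card_insert_of_notMem (by simp [hjl, hj]), cl]
    have h2 := Finset.card_le_univ (insert j (insert l D))
    rw [h1, Fintype.card_fin] at h2
    omega
  -- Of the four coalitions D, D ∪ {l}, D ∪ {j}, D ∪ {j, l}, the contrast keeps only the two middle
  -- ones.
  rw [kernelWeight_eq_shapleyWeight (insert l D) hDm cl,
    kernelWeight_eq_shapleyWeight (insert j D) hDm cj, cl, cj, Finset.insert_comm l j D]
  simp [ind, hl, hj, hjl, hjl.symm]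
  ring

lemma sum_shapleyWeight (j : Fin (m + 1)) :
    ∑ C ∈ (Finset.univ.erase j).powerset, shapleyWeight m C.card = 1 := by
  rw [Finset.sum_powerset_apply_card (shapleyWeight m)]
  have hc : (Finset.univ.erase j).card = m := by simp
  rw [hc, Finset.sum_congr rfl (g := fun _ => ((m : ℝ) + 1)⁻¹)]
  · simp
    field_simp
  · intro s hs
    have : (0 : ℝ) < m.choose s := by
      exact_mod_cast Nat.choose_pos (Nat.lt_succ_iff.1 (Finset.mem_range.1 hs))
    simp [shapleyWeight]
    field_simp

lemma shapley_dotProduct_ind (a : Fin (m + 1) → ℝ) (j : Fin (m + 1)) :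
    shapley (fun C => ind C ⬝ᵥ a) j = a j := by
  have key : ∀ C ∈ (Finset.univ.erase j).powerset,
      shapleyWeight m C.card * (ind (insert j C) ⬝ᵥ a - ind C ⬝ᵥ a) =
        shapleyWeight m C.card * a j := by
    intro C hC
    have hj : j ∉ C := fun h => by simpa using Finset.mem_powerset.1 hC h
    have : ind (insert j C) = ind C + Pi.single j 1 := by
      ext k
      rcases eq_or_ne k j with rfl | h
      · simp [ind, hj]
      · simp [ind, h]
    rw [this, add_dotProduct, single_one_dotProduct]
    ring
  rw [shapley_eq_sum_powerset, Finset.sum_congr rfl key, ← Finset.sum_mul, sum_shapleyWeight,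
    one_mul]

lemma shapley_eq_sum_coalition (ν : Coalition (m + 1) → ℝ) (j : Fin (m + 1)) :
    shapley ν j = ∑ D, (if j ∈ D then shapleyWeight m (D.card - 1)
      else -shapleyWeight m D.card) * ν D := by
  rw [sum_coalition_eq_sum_powerset_erase _ j, shapley_eq_sum_powerset]
  refine Finset.sum_congr rfl fun C hC => ?_
  have hj : j ∉ C := fun h => by simpa using Finset.mem_powerset.1 hC h
  simp [hj]
  ring

/-- Efficiency of the Shapley values. -/
lemma sum_shapley (ν : Coalition (m + 1) → ℝ) (hν : ν ∅ = 0) :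
    ∑ j, shapley ν j = ν Finset.univ := by
  simp_rw [shapley_eq_sum_coalition]
  rw [Finset.sum_comm, Finset.sum_eq_single Finset.univ]
  · simp [shapleyWeight]
    field_simp
  · intro D _ hD
    rcases Finset.eq_empty_or_nonempty D with rfl | hne
    · simp [hν]
    obtain ⟨s, hs⟩ : ∃ s, D.card = s + 1 := ⟨D.card - 1, by have := hne.card_pos; omega⟩
    have hsm : s < m := by
      have := Finset.card_lt_univ_of_notMem (s := D)
        (x := (by simpa [Finset.eq_univ_iff_forall] using hD : ∃ x, x ∉ D).choose)
        (by simpa [Finset.eq_univ_iff_forall] using hD : ∃ x, x ∉ D).choose_spec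
      rw [Fintype.card_fin] at this
      omega
    have hcompl : (Finset.univ.filter fun j => j ∉ D).card = m - s := by
      rw [← Finset.compl_filter, Finset.card_compl]
      simp [hs]
    -- The s + 1 members and m - s non-members of D contribute opposite totals, so every D other
    -- than the grand coalition cancels.
    have := shapleyWeight_succ hsm
    rw [← Finset.sum_mul, Finset.sum_ite, Finset.sum_const, Finset.sum_const, hcompl]
    simp only [hs, nsmul_eq_mul, Finset.filter_mem_eq_inter, Finset.univ_inter]
    rw [Nat.cast_sub hsm.le]
    push_cast
    rw [mul_neg, this]
    ring
  · simp

/-- By efficiency, eliminating the last player is only a reparametrization, so the residual is that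
of the symmetric additive model. -/
lemma residual_eq (ν : Coalition (m + 1) → ℝ) (hν : ν ∅ = 0) (C : Coalition (m + 1)) :
    response ν C - covariate C ⬝ᵥ (shapleyTilde ν).ofLp = ν C - ind C ⬝ᵥ shapley ν := by
  rw [response, ← sum_shapley ν hν, dotProduct, dotProduct, Fin.sum_univ_castSucc,
    Fin.sum_univ_castSucc]
  simp only [covariate, shapleyTilde, sub_mul, Finset.sum_sub_distrib, mul_add, Finset.mul_sum]
  ring

lemma response_sub_response_compl (ν : Coalition (m + 1) → ℝ) (C : Coalition (m + 1)) :
    (response ν C - covariate C ⬝ᵥ (shapleyTilde ν).ofLp) -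
      (response ν Cᶜ - covariate Cᶜ ⬝ᵥ (shapleyTilde ν).ofLp) = 2 * pairedResidual ν C := by
  rw [covariate_compl, pairedResidual, response, response, ind_compl, neg_dotProduct]
  ring

/-! ### Sampling probabilities, normal equations and positivity of 𝒥 -/

lemma prob_compl (C : Coalition (m + 1)) : prob (m + 1) Cᶜ = prob (m + 1) C := by
  have hle : C.card ≤ m + 1 := by simpa using C.card_le_univ
  have hc : Cᶜ.card = m + 1 - C.card := by simp [Finset.card_compl]
  have h1 : Cᶜ ≠ ∅ ↔ C ≠ Finset.univ := by simp
  have h2 : Cᶜ ≠ Finset.univ ↔ C ≠ ∅ := by simp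
  simp only [prob, kernelWeight, h1, h2, and_comm (a := C ≠ Finset.univ), hc,
    Nat.choose_symm hle, Nat.cast_sub hle, sub_sub_cancel]
  congr 2
  ring

lemma kernelWeight_nonneg (C : Coalition (m + 1)) : 0 ≤ kernelWeight (m + 1) C := by
  unfold kernelWeight
  split_ifs
  · have : (C.card : ℝ) ≤ (m + 1 : ℕ) := by exact_mod_cast by simpa using C.card_le_univ
    have h1 : (0 : ℝ) ≤ ((m + 1 : ℕ) : ℝ) - C.card := by linarith
    have h2 : (0 : ℝ) ≤ ((m + 1 : ℕ) : ℝ) - 1 := by simp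
    positivity
  · exact le_rfl

lemma kernelWeight_pos (hm : 1 ≤ m) {C : Coalition (m + 1)} (h0 : C ≠ ∅)
    (h1 : C ≠ Finset.univ) : 0 < kernelWeight (m + 1) C := by
  rw [kernelWeight, if_pos ⟨h0, h1⟩]
  have h2 : C.card < m + 1 := by
    simpa using Finset.card_lt_card (Finset.ssubset_univ_iff.2 h1)
  have h3 : (0 : ℝ) < C.card := by exact_mod_cast Finset.card_pos.2 (Finset.nonempty_iff_ne_empty.2 h0)
  have h4 : (0 : ℝ) < ((m + 1 : ℕ) : ℝ) - C.card := by
    have : (C.card : ℝ) < (m + 1 : ℕ) := by exact_mod_cast h2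
    linarith
  have h5 : (0 : ℝ) < (m + 1).choose C.card := by exact_mod_cast Nat.choose_pos h2.le
  have h6 : (0 : ℝ) < ((m + 1 : ℕ) : ℝ) - 1 := by
    push_cast
    have : (1 : ℝ) ≤ m := by exact_mod_cast hm
    linarith
  positivity

lemma prob_nonneg (C : Coalition (m + 1)) : 0 ≤ prob (m + 1) C :=
  mul_nonneg (inv_nonneg.2 (Finset.sum_nonneg fun _ _ => kernelWeight_nonneg _))
    (kernelWeight_nonneg C)

lemma prob_singleton_pos (hm : 1 ≤ m) (j : Fin (m + 1)) : 0 < prob (m + 1) {j} := by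
  have h : 0 < kernelWeight (m + 1) {j} := by
    refine kernelWeight_pos hm (Finset.singleton_ne_empty j) fun h => ?_
    have := congrArg Finset.card h
    simp at this
    omega
  refine mul_pos (inv_pos.2 (Finset.sum_pos' (fun _ _ => kernelWeight_nonneg _) ?_)) h
  exact ⟨_, Finset.mem_univ _, h⟩

/-- The normal equations: the Shapley values solve the kernel weighted least squares problem. -/
lemma sum_prob_smul_covariate_residual (ν : Coalition (m + 1) → ℝ) (hν : ν ∅ = 0) :
    ∑ C, (prob (m + 1) C * (response ν C - covariate C ⬝ᵥ (shapleyTilde ν).ofLp)) •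
      covariate C = 0 := by
  ext j
  have h1 := sum_kernelWeight_mul_ind_sub ν j.castSucc (Fin.last m)
  -- The additive game of the Shapley values has the same contrasts as ν, so subtracting the two
  -- identities leaves the residual.
  have h2 := sum_kernelWeight_mul_ind_sub (fun C => ind C ⬝ᵥ shapley ν) j.castSucc (Fin.last m)
  rw [shapley_dotProduct_ind, shapley_dotProduct_ind, ← h1, ← sub_eq_zero,
    ← Finset.sum_sub_distrib] at h2
  simp only [Finset.sum_apply, Pi.smul_apply, smul_eq_mul, residual_eq ν hν, prob, mul_assoc,
    ← Finset.mul_sum, Pi.zero_apply]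
  rw [← neg_eq_zero, ← Finset.sum_neg_distrib] at h2
  convert mul_zero _
  convert h2 using 2 with C
  simp only [covariate]
  ring

/-- Reindexing the normal equations by complements, where p is even and the covariate odd, gives a
second copy; the difference of the two is the paired version. -/
lemma sum_prob_smul_covariate_pairedResidual (ν : Coalition (m + 1) → ℝ) (hν : ν ∅ = 0) :
    ∑ C, (prob (m + 1) C * (2 * pairedResidual ν C)) • covariate C = 0 := by
  have h := sum_prob_smul_covariate_residual ν hν
  have h' : ∑ C : Coalition (m + 1), (prob (m + 1) C * (response ν Cᶜ - covariate Cᶜ ⬝ᵥ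
      (shapleyTilde ν).ofLp)) • covariate C = 0 := by
    rw [← neg_eq_zero, ← h, ← Finset.sum_neg_distrib]
    refine Fintype.sum_equiv (Function.Involutive.toPerm (compl : Coalition (m + 1) → _)
      compl_compl) _ _ fun C => ?_
    change _ = (prob (m + 1) Cᶜ * (response ν Cᶜ - covariate Cᶜ ⬝ᵥ
      (shapleyTilde ν).ofLp)) • covariate Cᶜ
    rw [prob_compl, covariate_compl C, smul_neg]
  rw [← sub_zero (0 : Fin m → ℝ)]
  nth_rewrite 1 [← h]
  rw [← h', ← Finset.sum_sub_distrib]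
  refine Finset.sum_congr rfl fun C _ => ?_
  rw [← response_sub_response_compl, mul_sub (prob (m + 1) _), sub_smul]

lemma dotProduct_sum_smul_vecMulVec_mulVec {κ ι : Type*} [Fintype κ] [Fintype ι] (p : κ → ℝ)
    (x : κ → ι → ℝ) (v : ι → ℝ) :
    v ⬝ᵥ ((∑ C, p C • Matrix.vecMulVec (x C) (x C)) *ᵥ v) = ∑ C, p C * (x C ⬝ᵥ v) ^ 2 := by
  simp only [Matrix.sum_mulVec, dotProduct_sum, Matrix.smul_mulVec, dotProduct_smul,
    Matrix.vecMulVec_mulVec, smul_eq_mul]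
  refine Finset.sum_congr rfl fun C _ => ?_
  rw [dotProduct_comm v, op_smul_eq_smul, smul_eq_mul, sq]

lemma covariate_singleton (j : Fin m) : covariate {j.castSucc} = Pi.single j 1 := by
  ext k
  simp [covariate, ind, Pi.single_apply, (Fin.castSucc_lt_last j).ne']

lemma matJ_isSymm : (matJ m)ᵀ = matJ m := by
  simp [matJ, Matrix.transpose_sum, Matrix.transpose_smul, Matrix.transpose_vecMulVec]

/-- Singletons of the first m players have positive probability, and their covariates form the
standard basis. -/
lemma matJ_posDef (hm : 1 ≤ m) : (matJ m).PosDef := by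
  refine Matrix.PosDef.of_dotProduct_mulVec_pos ?_ fun v hv => ?_
  · rw [Matrix.IsHermitian, Matrix.conjTranspose_eq_transpose_of_trivial, matJ_isSymm]
  · obtain ⟨j, hj⟩ := Function.ne_iff.1 hv
    rw [star_trivial, matJ, dotProduct_sum_smul_vecMulVec_mulVec]
    refine Finset.sum_pos' (fun C _ => mul_nonneg (prob_nonneg C) (sq_nonneg _))
      ⟨{j.castSucc}, Finset.mem_univ _, mul_pos (prob_singleton_pos hm _) ?_⟩
    rw [covariate_singleton, single_one_dotProduct]
    simpa using sq_pos_of_ne_zero hj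

lemma isUnit_det_matJ₂ (hm : 1 ≤ m) : IsUnit (matJ₂ m).det := by
  rw [matJ₂, Matrix.det_smul]
  exact (isUnit_iff_ne_zero.2 (by positivity)).mul (isUnit_iff_ne_zero.2 (matJ_posDef hm).det_pos.ne')

end Shapley

end KernelSHAP

/-! ### Multivariate central limit theorem -/

section CentralLimit

variable {ι Ω : Type*} [Fintype ι] {mΩ : MeasurableSpace Ω} {P : Measure Ω}

lemma charFun_map_eq_charFun_map_inner {X : Ω → EuclideanSpace ℝ ι} (hX : AEMeasurable X P)
    (t : EuclideanSpace ℝ ι) :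
    charFun (P.map X) t = charFun (P.map fun ω => inner ℝ (X ω) t) 1 := by
  rw [charFun_apply, charFun_apply, integral_map hX (by fun_prop),
    integral_map (by fun_prop) (by fun_prop)]
  simp

/-- The multivariate central limit theorem for centered random vectors. The limit may be
degenerate. -/
theorem tendstoInDistribution_inv_sqrt_smul_sum [DecidableEq ι] [IsProbabilityMeasure P]
    {X : ℕ → Ω → EuclideanSpace ℝ ι} {S : Matrix ι ι ℝ} (hS : S.PosSemidef)
    (hX : MemLp (X 0) 2 P) (h0 : P[X 0] = 0)
    (hcov : ∀ t : EuclideanSpace ℝ ι, ∫ ω, inner ℝ (X 0 ω) t ^ 2 ∂P = t.ofLp ⬝ᵥ S *ᵥ t.ofLp)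
    (hindep : iIndepFun X P) (hident : ∀ i, IdentDistrib (X i) (X 0) P P) :
    TendstoInDistribution (fun (n : ℕ) ω => (√(n : ℝ))⁻¹ • ∑ k ∈ Finset.range n, X k ω) atTop id
      (fun _ => P) (multivariateGaussian 0 S) where
  forall_aemeasurable n :=
    (Finset.aemeasurable_fun_sum _ fun _ _ => (hident _).aemeasurable_fst).fun_const_smul _
  tendsto := by
    refine ProbabilityMeasure.tendsto_iff_tendsto_charFun.2 fun t => ?_
    have hm : Measurable fun x : EuclideanSpace ℝ ι => inner ℝ x t := by fun_prop
    have hmean : ∫ ω, inner ℝ (X 0 ω) t ∂P = 0 := by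
      simp_rw [real_inner_comm t]
      rw [integral_inner (hX.integrable (by norm_num)), h0, inner_zero_right]
    have hvar : Var[fun ω => inner ℝ (X 0 ω) t; P] = t.ofLp ⬝ᵥ S *ᵥ t.ofLp := by
      rw [variance_of_integral_eq_zero (X := fun ω => inner ℝ (X 0 ω) t)
        (hm.comp_aemeasurable hX.aemeasurable) hmean, ← hcov]
    -- Cramér–Wold: the characteristic function at t is that of the projection onto t, evaluated at
    -- 1.
    have hclt := (tendstoInDistribution_inv_sqrt_mul_sum_sub (P := P)
      (X := fun n ω => inner ℝ (X n ω) t) HasLaw.id (hX.inner_const t)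
      (hindep.comp _ fun _ => hm) fun i => (hident i).comp hm).tendsto
    have hlim := ProbabilityMeasure.tendsto_iff_tendsto_charFun.1 hclt 1
    have hnn : 0 ≤ t.ofLp ⬝ᵥ S *ᵥ t.ofLp := hvar ▸ variance_nonneg _ _
    simp only [hmean, mul_zero, sub_zero, hvar, Measure.map_id, ProbabilityMeasure.coe_mk,
      charFun_gaussianReal] at hlim
    simp only [ProbabilityMeasure.coe_mk, Measure.map_id, charFun_multivariateGaussian hS]
    convert hlim using 2 with n
    · rw [charFun_map_eq_charFun_map_inner]
      · simp [real_inner_smul_left, sum_inner]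
      · exact (Finset.aemeasurable_fun_sum _
          fun _ _ => (hident _).aemeasurable_fst).fun_const_smul _
    · simp [hnn]

end CentralLimit

/-! ### Algebra of the paired estimator and its linearization -/

namespace KernelSHAP

variable {m : ℕ}

lemma integral_law {E : Type*} [NormedAddCommGroup E] [NormedSpace ℝ E] [CompleteSpace E]
    (f : Coalition (m + 1) → E) :
    ∫ C, f C ∂(law (m + 1)) = ∑ C, prob (m + 1) C • f C := by
  rw [law, integral_finsetSum_measure]
  · simp [integral_smul_measure, ENNReal.toReal_ofReal, prob_nonneg]
  · exact fun C _ => (integrable_dirac (by simp)).smul_measure ENNReal.ofReal_ne_top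

/-- The gram matrix of the paired design. -/
lemma gram_paired {n : ℕ} (c : Fin n → Coalition (m + 1)) :
    (design (paired c))ᵀ * design (paired c) =
      ∑ i, (2 : ℝ) • Matrix.vecMulVec (covariate (c i)) (covariate (c i)) := by
  ext j k
  simp [Matrix.mul_apply, design, paired, covariate_compl, Matrix.sum_apply,
    Matrix.vecMulVec_apply, ← Finset.sum_add_distrib, two_mul]

lemma design_transpose_mulVec_residual {n : ℕ} (ν : Coalition (m + 1) → ℝ)
    (c : Fin n → Coalition (m + 1)) :
    (design (paired c))ᵀ *ᵥ ((fun i => response ν (paired c i)) -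
        design (paired c) *ᵥ (shapleyTilde ν).ofLp) =
      ∑ i, (2 * pairedResidual ν (c i)) • covariate (c i) := by
  ext j
  simp only [← response_sub_response_compl, Matrix.mulVec, dotProduct, Fintype.sum_sum_type,
    Finset.sum_apply, ← Finset.sum_add_distrib]
  refine Finset.sum_congr rfl fun i _ => ?_
  simp [design, paired, covariate_compl, dotProduct, Matrix.mulVec]
  ring

lemma rank_eq_of_isUnit_det_gram {κ : Type*} [Fintype κ] {A : Matrix κ (Fin m) ℝ}
    (h : IsUnit (Aᵀ * A).det) : A.rank = m := by
  refine le_antisymm (by simpa using A.rank_le_card_width) ?_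
  have h1 := Matrix.rank_of_isUnit _ ((Matrix.isUnit_iff_isUnit_det _).2 h)
  rw [Fintype.card_fin] at h1
  exact h1.symm.le.trans (Matrix.rank_mul_le_right _ _)

lemma estimate_sub_shapleyTilde {n : ℕ} (ν : Coalition (m + 1) → ℝ)
    (c : Fin n → Coalition (m + 1))
    (h : IsUnit ((design (paired c))ᵀ * design (paired c)).det) :
    (estimate ν (paired c) - shapleyTilde ν).ofLp =
      ((design (paired c))ᵀ * design (paired c))⁻¹ *ᵥ
        ∑ i, (2 * pairedResidual ν (c i)) • covariate (c i) := by
  rw [← design_transpose_mulVec_residual, Matrix.mulVec_sub, Matrix.mulVec_sub,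
    Matrix.mulVec_mulVec (shapleyTilde ν).ofLp, Matrix.mulVec_mulVec (shapleyTilde ν).ofLp,
    Matrix.nonsing_inv_mul _ h, Matrix.one_mulVec]
  rfl

/-- The contribution of a coalition to the linearized estimation error. -/
noncomputable def influence (ν : Coalition (m + 1) → ℝ) (C : Coalition (m + 1)) :
    EuclideanSpace ℝ (Fin m) :=
  WithLp.toLp 2 ((matJ₂ m)⁻¹ *ᵥ ((2 * pairedResidual ν C) • covariate C))

lemma sum_prob_smul_influence (ν : Coalition (m + 1) → ℝ) (hν : ν ∅ = 0) :
    ∑ C, prob (m + 1) C • influence ν C = 0 := by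
  have h := congrArg (fun v => WithLp.toLp 2 ((matJ₂ m)⁻¹ *ᵥ v))
    (sum_prob_smul_covariate_pairedResidual ν hν)
  simpa [influence, Matrix.mulVec_sum, Matrix.mulVec_smul, mul_smul] using h

lemma matT₂_eq_sum (ν : Coalition (m + 1) → ℝ) :
    matT₂ ν = ∑ C, prob (m + 1) C •
      Matrix.vecMulVec (influence ν C).ofLp (influence ν C).ofLp := by
  have hJ : ((matJ₂ m)⁻¹)ᵀ = (matJ₂ m)⁻¹ := by
    rw [Matrix.transpose_nonsing_inv, matJ₂, Matrix.transpose_smul, matJ_isSymm]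
  simp only [matT₂, matI₂, Finset.mul_sum, Finset.sum_mul]
  refine Finset.sum_congr rfl fun C _ => ?_
  have h : ∀ v w : Fin m → ℝ, (matJ₂ m)⁻¹ * Matrix.vecMulVec v w * (matJ₂ m)⁻¹ =
      Matrix.vecMulVec ((matJ₂ m)⁻¹ *ᵥ v) ((matJ₂ m)⁻¹ *ᵥ w) := by
    intro v w
    rw [Matrix.mul_vecMulVec, Matrix.vecMulVec_mul, ← Matrix.mulVec_transpose, hJ]
  simp only [influence, ← h, Matrix.vecMulVec_smul, Matrix.smul_vecMulVec, Matrix.mul_smul,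
    Matrix.smul_mul, smul_smul]
  congr 2
  ring

lemma dotProduct_matT₂_mulVec (ν : Coalition (m + 1) → ℝ) (v : Fin m → ℝ) :
    v ⬝ᵥ (matT₂ ν *ᵥ v) = ∑ C, prob (m + 1) C * ((influence ν C).ofLp ⬝ᵥ v) ^ 2 := by
  rw [matT₂_eq_sum, dotProduct_sum_smul_vecMulVec_mulVec]

lemma matT₂_posSemidef (ν : Coalition (m + 1) → ℝ) : (matT₂ ν).PosSemidef := by
  refine Matrix.PosSemidef.of_dotProduct_mulVec_nonneg ?_ fun v => ?_
  · rw [Matrix.IsHermitian, Matrix.conjTranspose_eq_transpose_of_trivial, matT₂_eq_sum]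
    simp [Matrix.transpose_sum, Matrix.transpose_smul, Matrix.transpose_vecMulVec]
  · rw [star_trivial, dotProduct_matT₂_mulVec]
    exact Finset.sum_nonneg fun C _ => mul_nonneg (prob_nonneg C) (sq_nonneg _)

end KernelSHAP

/-! ### Limit theorems for the sampled coalitions -/

namespace KernelSHAP

variable {m : ℕ} {Ω : Type*} [MeasurableSpace Ω] {P : Measure Ω}
  {Z : ℕ → Ω → Coalition (m + 1)}

lemma integral_comp_of_hasLaw {E : Type*} [NormedAddCommGroup E] [NormedSpace ℝ E]
    [CompleteSpace E] {X : Ω → Coalition (m + 1)} (hX : HasLaw X (law (m + 1)) P)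
    (f : Coalition (m + 1) → E) : ∫ ω, f (X ω) ∂P = ∑ C, prob (m + 1) C • f C := by
  rw [← integral_law, ← hX.map_eq, integral_map hX.aemeasurable
    (StronglyMeasurable.of_discrete).aestronglyMeasurable]

lemma memLp_comp_of_hasLaw [IsProbabilityMeasure P] {E : Type*} [NormedAddCommGroup E] {X : Ω → Coalition (m + 1)}
    (hX : HasLaw X (law (m + 1)) P) (f : Coalition (m + 1) → E) (p : ENNReal) :
    MemLp (fun ω => f (X ω)) p P :=
  MemLp.of_bound ((StronglyMeasurable.of_discrete (f := f)).aestronglyMeasurable.comp_aemeasurable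
    hX.aemeasurable) (∑ C, ‖f C‖) (.of_forall fun ω =>
      Finset.single_le_sum (f := fun C => ‖f C‖) (fun _ _ => norm_nonneg _) (Finset.mem_univ (X ω)))

lemma tendstoInDistribution_influence [IsProbabilityMeasure P] (ν : Coalition (m + 1) → ℝ) (hν : ν ∅ = 0)
    (hZ : ∀ i, HasLaw (Z i) (law (m + 1)) P) (hindep : iIndepFun Z P) :
    TendstoInDistribution
      (fun (n : ℕ) ω => (√(n : ℝ))⁻¹ • ∑ k ∈ Finset.range n, influence ν (Z k ω)) atTop id
      (fun _ => P) (multivariateGaussian 0 (matT₂ ν)) := by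
  refine tendstoInDistribution_inv_sqrt_smul_sum (X := fun k ω => influence ν (Z k ω))
    (matT₂_posSemidef ν) (memLp_comp_of_hasLaw (hZ 0) _ 2) ?_ (fun t => ?_)
    (hindep.comp (fun _ => influence ν) fun _ => .of_discrete) fun i => ?_
  · rw [integral_comp_of_hasLaw (hZ 0), sum_prob_smul_influence ν hν]
  · rw [integral_comp_of_hasLaw (hZ 0) fun C => inner ℝ (influence ν C) t ^ 2,
      dotProduct_matT₂_mulVec]
    simp [EuclideanSpace.inner_eq_star_dotProduct, dotProduct_comm]
  · exact IdentDistrib.comp ((hZ i).identDistrib (hZ 0)) (u := influence ν) .of_discrete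

/-- The gram matrix of the first `n` sampled pairs. -/
def gram (c : ℕ → Coalition (m + 1)) (n : ℕ) : Matrix (Fin m) (Fin m) ℝ :=
  (design (paired fun i : Fin n => c i))ᵀ * design (paired fun i : Fin n => c i)

lemma ae_tendsto_gram [IsProbabilityMeasure P] (hZ : ∀ i, HasLaw (Z i) (law (m + 1)) P) (hindep : iIndepFun Z P) :
    ∀ᵐ ω ∂P, Tendsto (fun n : ℕ => (n : ℝ)⁻¹ • gram (fun i => Z i ω) n) atTop
      (𝓝 (matJ₂ m)) := by
  have h (j k : Fin m) : ∀ᵐ ω ∂P, Tendsto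
      (fun n : ℕ => (n : ℝ)⁻¹ • gram (fun i => Z i ω) n j k) atTop (𝓝 (matJ₂ m j k)) := by
    let f : Coalition (m + 1) → ℝ := fun C => 2 * (covariate C j * covariate C k)
    have := strong_law_ae (μ := P) (fun i ω => f (Z i ω))
      (memLp_one_iff_integrable.1 (memLp_comp_of_hasLaw (hZ 0) f 1))
      (fun a b hab => (hindep.comp (fun _ => f) fun _ => .of_discrete).indepFun hab)
      fun i => IdentDistrib.comp ((hZ i).identDistrib (hZ 0)) (u := f) .of_discrete
    filter_upwards [this] with ω hω
    rw [integral_comp_of_hasLaw (hZ 0)] at hω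
    convert hω using 2 with n
    · rw [gram, gram_paired, Matrix.sum_apply, Finset.sum_range]
      simp [f, Matrix.vecMulVec_apply]
    · rw [matJ₂, matJ, Finset.smul_sum, Matrix.sum_apply]
      refine Finset.sum_congr rfl fun C _ => ?_
      simp [f, Matrix.vecMulVec_apply]
      ring
  filter_upwards [ae_all_iff.2 fun j => ae_all_iff.2 (h j)] with ω hω
  exact tendsto_pi_nhds.2 fun j => tendsto_pi_nhds.2 (hω j)

lemma eventually_isUnit_det_gram (hm : 1 ≤ m) {c : ℕ → Coalition (m + 1)}
    (h : Tendsto (fun n : ℕ => (n : ℝ)⁻¹ • gram c n) atTop (𝓝 (matJ₂ m))) :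
    ∀ᶠ n in atTop, IsUnit (gram c n).det := by
  have h1 : Tendsto (fun n : ℕ => ((n : ℝ)⁻¹ • gram c n).det) atTop (𝓝 (matJ₂ m).det) :=
    ((continuous_id.matrix_det).tendsto _).comp h
  filter_upwards [h1.eventually_ne (isUnit_det_matJ₂ hm).ne_zero] with n hn
  rw [Matrix.det_smul] at hn
  exact isUnit_iff_ne_zero.2 (right_ne_zero_of_mul hn)

lemma tendsto_smul_inv_gram_mul (hm : 1 ≤ m) {c : ℕ → Coalition (m + 1)}
    (h : Tendsto (fun n : ℕ => (n : ℝ)⁻¹ • gram c n) atTop (𝓝 (matJ₂ m))) :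
    Tendsto (fun n : ℕ => (n : ℝ) • ((gram c n)⁻¹ * matJ₂ m)) atTop (𝓝 1) := by
  have hu := isUnit_det_matJ₂ hm
  have hinv : Tendsto (fun n : ℕ => ((n : ℝ)⁻¹ • gram c n)⁻¹) atTop (𝓝 (matJ₂ m)⁻¹) := by
    -- Writing the inverse as adjugate over determinant reduces its continuity at 𝒥₂ to a nonzero
    -- determinant.
    simp only [Matrix.inv_def, Ring.inverse_eq_inv']
    exact ((((continuous_id.matrix_det).tendsto _).comp h).inv₀ hu.ne_zero).smul
      (((continuous_id.matrix_adjugate).tendsto _).comp h)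
  have hmul := ((continuous_id.matrix_mul (continuous_const (y := matJ₂ m))).tendsto _).comp hinv
  rw [id, Matrix.nonsing_inv_mul _ hu] at hmul
  refine hmul.congr' ?_
  filter_upwards [eventually_isUnit_det_gram hm h, eventually_ne_atTop 0] with n hn hn0
  have : ((n : ℝ)⁻¹ • gram c n)⁻¹ = (n : ℝ) • (gram c n)⁻¹ := by
    refine Matrix.inv_eq_left_inv ?_
    rw [Matrix.smul_mul, Matrix.mul_smul, Matrix.nonsing_inv_mul _ hn, smul_smul,
      mul_inv_cancel₀ (by exact_mod_cast hn0), one_smul]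
  simp [this]

lemma sqrt_smul_estimate_sub {c : ℕ → Coalition (m + 1)} (hm : 1 ≤ m)
    (ν : Coalition (m + 1) → ℝ) {n : ℕ} (h : IsUnit (gram c n).det) :
    √(n : ℝ) • (estimate ν (paired fun i : Fin n => c i) - shapleyTilde ν) =
      WithLp.toLp 2 (((n : ℝ) • ((gram c n)⁻¹ * matJ₂ m)) *ᵥ
        ((√(n : ℝ))⁻¹ • ∑ k ∈ Finset.range n, influence ν (c k)).ofLp) := by
  have hs : (n : ℝ) * (√(n : ℝ))⁻¹ = √(n : ℝ) := by
    rw [← div_eq_mul_inv, Real.div_sqrt]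
  have hsum : (∑ k ∈ Finset.range n, influence ν (c k)).ofLp =
      (matJ₂ m)⁻¹ *ᵥ ∑ i : Fin n, (2 * pairedResidual ν (c i)) • covariate (c i) := by
    rw [Matrix.mulVec_sum, Finset.sum_range]
    simp [influence]
  apply WithLp.ofLp_injective
  rw [WithLp.ofLp_smul, estimate_sub_shapleyTilde ν _ h, WithLp.ofLp_smul, hsum,
    Matrix.mulVec_smul, Matrix.smul_mulVec, smul_smul, mul_comm, hs, Matrix.mulVec_mulVec,
    Matrix.mul_assoc, Matrix.mul_nonsing_inv _ (isUnit_det_matJ₂ hm), Matrix.mul_one]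
  rfl

end KernelSHAP

/-! ### Slutsky's argument -/

theorem mainTheorem2 {m : ℕ} (hm : 1 ≤ m)
    (ν : KernelSHAP.Coalition (m + 1) → ℝ) (hν₀ : ν ∅ = 0)
    (hν : ¬ KernelSHAP.IsBilinearForm ν)
    {Ω : Type*} [MeasurableSpace Ω] (P : Measure Ω) [IsProbabilityMeasure P]
    (Z : ℕ → Ω → KernelSHAP.Coalition (m + 1))
    (hZ : ∀ i, HasLaw (Z i) (KernelSHAP.law (m + 1)) P)
    (hindep : iIndepFun Z P)
    (φhat : ℕ → Ω → EuclideanSpace ℝ (Fin m))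
    (hφ : KernelSHAP.IsPairedEstimator P ν Z φhat) :
    IsUnit (KernelSHAP.matJ₂ m).det ∧
    (KernelSHAP.matT₂ ν).PosSemidef ∧
    TendstoInDistribution
      (fun (n : ℕ) ω => √(n : ℝ) • (φhat n ω - KernelSHAP.shapleyTilde ν))
      atTop id (fun _ => P) (multivariateGaussian 0 (KernelSHAP.matT₂ ν)) := by
  refine ⟨KernelSHAP.isUnit_det_matJ₂ hm, KernelSHAP.matT₂_posSemidef ν, ?_⟩
  have hlim := KernelSHAP.ae_tendsto_gram hZ hindep
  have hclt := KernelSHAP.tendstoInDistribution_influence ν hν₀ hZ hindep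
  let B : ℕ → Ω → Fin m → Fin m → ℝ := fun n ω =>
    (n : ℝ) • ((KernelSHAP.gram (fun i => Z i ω) n)⁻¹ * KernelSHAP.matJ₂ m)
  -- B n is a function of the first n coalitions, which range over a discrete space.
  have hB : ∀ n, AEMeasurable (B n) P := fun n =>
    (Measurable.of_discrete (f := fun c : Fin n → KernelSHAP.Coalition (m + 1) =>
      show Fin m → Fin m → ℝ from
        (n : ℝ) • (((KernelSHAP.design (KernelSHAP.paired c))ᵀ *
          KernelSHAP.design (KernelSHAP.paired c))⁻¹ * KernelSHAP.matJ₂ m))).comp_aemeasurable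
      (aemeasurable_pi_iff.2 fun i : Fin n => (hZ i).aemeasurable)
  have hBlim : TendstoInMeasure P B atTop
      fun _ => ((1 : Matrix (Fin m) (Fin m) ℝ) : Fin m → Fin m → ℝ) := by
    refine tendstoInMeasure_of_tendsto_ae (fun n => (hB n).aestronglyMeasurable) ?_
    filter_upwards [hlim] with ω hω
    exact KernelSHAP.tendsto_smul_inv_gram_mul hm hω
  let g : EuclideanSpace ℝ (Fin m) × (Fin m → Fin m → ℝ) → EuclideanSpace ℝ (Fin m) :=
    fun x => WithLp.toLp 2 (Matrix.of x.2 *ᵥ x.1.ofLp)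
  have hg : Continuous g :=
    (PiLp.continuous_toLp 2 _).comp (Continuous.matrix_mulVec (by exact continuous_snd)
      ((PiLp.continuous_ofLp 2 _).comp continuous_fst))
  have hslutsky := hclt.continuous_comp_prodMk_of_tendstoInMeasure_const hg hBlim hB
  have hmain : ∀ n : ℕ, AEMeasurable (fun ω => √(n : ℝ) • (φhat n ω - KernelSHAP.shapleyTilde ν)) P :=
    fun n => ((hφ.aemeasurable n).sub_const _).fun_const_smul _
  refine tendstoInDistribution_of_tendstoInMeasure_sub _ _ (hslutsky.congr (fun _ => .rfl)
    (.of_forall fun x => ?_)) ?_ hmain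
  · change WithLp.toLp 2 ((1 : Matrix (Fin m) (Fin m) ℝ) *ᵥ x.ofLp) = x
    simp
  · refine tendstoInMeasure_of_tendsto_ae (fun n =>
      ((hmain n).sub (hslutsky.forall_aemeasurable n)).aestronglyMeasurable) ?_
    filter_upwards [hlim] with ω hω
    -- For almost every ω the design eventually has full rank, so the difference is eventually
    -- exactly zero; the arbitrary values of the estimator do not matter.
    refine tendsto_const_nhds.congr' ?_
    filter_upwards [KernelSHAP.eventually_isUnit_det_gram hm hω] with n hn
    have := KernelSHAP.sqrt_smul_estimate_sub hm ν hn
    simp only [Pi.sub_apply, Pi.zero_apply]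
    rw [hφ.eq_estimate n ω (KernelSHAP.rank_eq_of_isUnit_det_gram hn), this]
    exact (sub_self _).symm
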